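/- Let $Q_n$ be the $n$-dimensional hypercube, that is, the graph whose vertices are the subsets of $\{1,\ldots,n\}$, where two vertices $u,v$ are adjacent if and only if one of them is obtained from the other by adding exactly one element. For a vertex $v$ let $N[v]$ be the set consisting of $v$ and its neighbours; a set $S$ of vertices is dominating if $\bigcup_{v\in S}N[v]=V(Q_n)$, and the domination number $\gamma(Q_n)$ is the least size of a dominating set of $Q_n$. Then $$\gamma(Q_{12})\geq 348,\qquad \gamma(Q_{18})\geq 14666,\qquad \gamma(Q_{24})\geq 701709,\qquad \gamma(Q_{30})\geq 35876816.$$ -/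

import Mathlib

/-- The `n`-dimensional hypercube `Q_n`: the vertices are the subsets of an `n`-element set, and two
vertices are adjacent when one of them is obtained from the other by adding exactly one element. -/
def hypercube (n : ℕ) : SimpleGraph (Finset (Fin n)) where
  Adj u v := (u ⊂ v ∧ (v \ u).card = 1) ∨ (v ⊂ u ∧ (u \ v).card = 1)
  symm := ⟨fun _ _ h => h.symm⟩
  loopless := ⟨fun u h => h.elim (fun h => (ssubset_irrefl u) h.1) (fun h => (ssubset_irrefl u) h.1)⟩

/-- The closed neighbourhood `N[v]` of a vertex: `v` together with its neighbours. -/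
def closedNbhd {V : Type*} (G : SimpleGraph V) (v : V) : Set V :=
  {u | u = v ∨ G.Adj v u}

/-- A set of vertices is dominating if its closed neighbourhood `N[S] = ⋃ v ∈ S, N[v]` is the whole
vertex set. -/
def IsDominatingSet {V : Type*} (G : SimpleGraph V) (S : Finset V) : Prop :=
  (⋃ v ∈ S, closedNbhd G v) = Set.univ

/-- The domination number of a finite graph: the least size of a dominating set. -/
noncomputable def dominationNumber {V : Type*} [Fintype V] (G : SimpleGraph V) : ℕ :=
  sInf {k : ℕ | ∃ S : Finset V, IsDominatingSet G S ∧ S.card = k}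

/-- The minimum in the definition of the domination number is attained. -/
theorem exists_card_eq_dominationNumber {V : Type*} [Fintype V] (G : SimpleGraph V) :
    ∃ S : Finset V, IsDominatingSet G S ∧ S.card = dominationNumber G := by
  have hne : {k : ℕ | ∃ S : Finset V, IsDominatingSet G S ∧ S.card = k}.Nonempty := by
    refine ⟨_, Finset.univ, ?_, rfl⟩
    refine Set.eq_univ_of_forall fun u => Set.mem_iUnion₂.2 ⟨u, Finset.mem_univ u, Or.inl rfl⟩
  exact Nat.sInf_mem hne

/-! Let e(v) be the number of codewords in N[v] minus one. For 6 ∣ n and n ≥ 12 the goal is (n-2)2^n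
≤ (n²-2n-2)|C|. Since Σ e = (n+1)|C| - 2^n, this amounts to 2^n - |C| ≤ (n-3) Σ e, which is
`Covers.card_compl_le`.

For even n the sum of e over the ball of a noncodeword is odd, hence at least 1. A ball centred at v
contains n - e(v) noncodewords, so double counting alone gives the factor n-1. Discharging, with all
weights scaled by 3, improves this to n-3. A noncodeword whose ball sum exceeds 1 has a surplus,
which it sends as a charge of 2 or 3 to each vertex of excess one ("light") in its ball
(`Covers.charge_balance`). Vertices of excess at least two ("heavy") have slack of their own and
make further donations.

Every light vertex receives at least 6 (`Covers.six_le_charge_add_donation`), which lowers its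
weight from 3(n-1) to 3(n-3). With no heavy vertex within distance two, receiving less would confine
the nearby excess to three or four directions; the parity conditions and a congruence mod 3
(`Covers.three_dvd`) exclude this. -/

section HypercubeDomination

open Finset

/-! ### Coordinate flips and ball sums -/

/-- The vertex obtained from `v` by changing the membership of `i`. -/
def toggle {n : ℕ} (v : Finset (Fin n)) (i : Fin n) : Finset (Fin n) := symmDiff v {i}

theorem toggle_toggle {n : ℕ} (v : Finset (Fin n)) (i : Fin n) : toggle (toggle v i) i = v := by
  simp [toggle]

theorem toggle_comm {n : ℕ} (v : Finset (Fin n)) (i j : Fin n) :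
    toggle (toggle v i) j = toggle (toggle v j) i := by
  simp only [toggle]
  exact symmDiff_right_comm _ _ _

theorem sum_toggle {n : ℕ} {M : Type*} [AddCommMonoid M] (f : Finset (Fin n) → M) (i : Fin n) :
    ∑ v, f (toggle v i) = ∑ v, f v :=
  Equiv.sum_comp (Function.Involutive.toPerm (fun v => toggle v i) (fun v => toggle_toggle v i)) f

/-- The sum of `f` over the closed neighbourhood of `v`. -/
def ballSum {n : ℕ} (f : Finset (Fin n) → ℕ) (v : Finset (Fin n)) : ℕ :=
  f v + ∑ i, f (toggle v i)

/-- Adjacency is symmetric, so the ball sum is a self-adjoint operator; every double count below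
uses this. -/
theorem sum_mul_ballSum {n : ℕ} (f g : Finset (Fin n) → ℕ) :
    ∑ v, f v * ballSum g v = ∑ v, g v * ballSum f v := by
  simp only [ballSum, mul_add, sum_add_distrib, mul_sum]
  congr 1
  · exact sum_congr rfl fun v _ => mul_comm _ _
  · rw [sum_comm]
    conv_rhs => rw [sum_comm]
    refine sum_congr rfl fun i _ => ?_
    rw [← sum_toggle _ i]
    exact sum_congr rfl fun v _ => by rw [toggle_toggle, mul_comm]

theorem two_neighbours_le_ballSum {n : ℕ} (f : Finset (Fin n) → ℕ) (v : Finset (Fin n))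
    {i j : Fin n} (h : i ≠ j) : f v + f (toggle v i) + f (toggle v j) ≤ ballSum f v := by
  have : ∑ k ∈ {i, j}, f (toggle v k) ≤ ∑ k, f (toggle v k) :=
    sum_le_sum_of_subset (subset_univ _)
  rw [sum_pair h] at this
  unfold ballSum
  omega

theorem neighbour_le_ballSum {n : ℕ} (f : Finset (Fin n) → ℕ) (v : Finset (Fin n))
    (i : Fin n) : f v + f (toggle v i) ≤ ballSum f v := by
  have : f (toggle v i) ≤ ∑ k, f (toggle v k) :=
    single_le_sum (f := fun k => f (toggle v k)) (fun _ _ => Nat.zero_le _) (mem_univ i)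
  unfold ballSum
  omega

/-! ### The adjacency operator modulo 2 and 3 -/

/-- The (i, j) and (j, i) terms cancel mod 2; each of the n diagonal terms returns to `v`. -/
theorem sum_sum_toggle_mod_two {n : ℕ} (f : Finset (Fin n) → ZMod 2) (v : Finset (Fin n)) :
    ∑ i, ∑ j, f (toggle (toggle v i) j) = n * f v := by
  rw [← sum_product', univ_product_univ, ← sum_filter_add_sum_filter_not univ
    (fun p : Fin n × Fin n => p.1 = p.2)]
  have h1 : ∑ p : Fin n × Fin n with ¬ p.1 = p.2, f (toggle (toggle v p.1) p.2) = 0 := by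
    refine sum_involution (fun p _ => p.swap) ?_ ?_ ?_ ?_
    · intro p _
      simp only [Prod.fst_swap, Prod.snd_swap]
      rw [toggle_comm v p.2 p.1]
      exact CharTwo.add_self_eq_zero _
    · intro p hp _ h
      simp only [mem_filter, mem_univ, true_and] at hp
      exact hp (by simpa using congrArg Prod.snd h)
    · intro p hp
      simp only [mem_filter, mem_univ, true_and] at hp ⊢
      exact fun h => hp h.symm
    · intro p _
      simp
  have h2 : ∑ p : Fin n × Fin n with p.1 = p.2, f (toggle (toggle v p.1) p.2) = n * f v := by
    rw [sum_filter, ← univ_product_univ, sum_product]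
    simp [toggle_toggle]
  rw [h1, h2, add_zero]

/-- Summation over the neighbours in the coordinate directions `s`, as an operator mod `3`. -/
def neighbourSum {n : ℕ} (s : Finset (Fin n)) :
    Module.End (ZMod 3) (Finset (Fin n) → ZMod 3) where
  toFun f v := ∑ i ∈ s, f (toggle v i)
  map_add' f g := by ext v; simp [sum_add_distrib]
  map_smul' c f := by ext v; simp [mul_sum]

theorem neighbourSum_commute {n : ℕ} (s t : Finset (Fin n)) :
    Commute (neighbourSum s) (neighbourSum t) := by
  refine LinearMap.ext fun f => funext fun v => ?_
  simp only [Module.End.mul_apply, neighbourSum, LinearMap.coe_mk, AddHom.coe_mk]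
  rw [sum_comm]
  exact sum_congr rfl fun i _ => sum_congr rfl fun j _ => by rw [toggle_comm]

/-- Single flips commute and are involutions, hence equal their own cubes; cubing is additive on
commuting operators in characteristic 3. -/
theorem neighbourSum_pow_three {n : ℕ} (s : Finset (Fin n)) :
    neighbourSum s ^ 3 = neighbourSum s := by
  have three : (3 : Module.End (ZMod 3) (Finset (Fin n) → ZMod 3)) = 0 := by
    have h : ((3 : ZMod 3) • (1 : Module.End (ZMod 3) (Finset (Fin n) → ZMod 3))) = 0 := by
      rw [show (3 : ZMod 3) = 0 from rfl, zero_smul]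
    rw [← h, ofNat_smul_eq_nsmul, nsmul_eq_mul, mul_one]
    rfl
  induction s using Finset.induction_on with
  | empty =>
    have : neighbourSum (∅ : Finset (Fin n)) = 0 := by
      refine LinearMap.ext fun f => funext fun v => ?_
      simp [neighbourSum]
    rw [this]
    simp
  | insert a s ha ih =>
    have hsplit : neighbourSum (insert a s) = neighbourSum {a} + neighbourSum s := by
      refine LinearMap.ext fun f => funext fun v => ?_
      simp [neighbourSum, sum_insert ha]
    have hsingle : neighbourSum {a} ^ 3 = neighbourSum {a} := by
      refine LinearMap.ext fun f => funext fun v => ?_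
      simp [neighbourSum, pow_succ, toggle_toggle]
    have hc := (neighbourSum_commute {a} s).eq
    have hexp : ∀ x y : Module.End (ZMod 3) (Finset (Fin n) → ZMod 3), x * y = y * x →
        (x + y) ^ 3 = x ^ 3 + y ^ 3 + 3 * (x * x * y + x * y * y) := by
      intro x y h
      rw [(show Commute x y from h).add_pow]
      have h3 : (Nat.choose 3 2 : Module.End (ZMod 3) (Finset (Fin n) → ZMod 3)) = 0 := by
        rw [← three]; norm_num [Nat.choose]
      have h3b : (Nat.choose 3 1 : Module.End (ZMod 3) (Finset (Fin n) → ZMod 3)) = 0 := by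
        rw [← three]; norm_num [Nat.choose]
      simp only [sum_range_succ, range_zero, sum_empty, three, h3, h3b]
      simp [add_comm]
    rw [hsplit, hexp _ _ hc, three, zero_mul, add_zero, hsingle, ih]

theorem sum_toggle_pow_three {n : ℕ} (f : Finset (Fin n) → ZMod 3) (v : Finset (Fin n)) :
    ∑ i, ∑ j, ∑ k, f (toggle (toggle (toggle v i) j) k) = ∑ i, f (toggle v i) := by
  have h := congrFun (LinearMap.congr_fun (neighbourSum_pow_three (univ : Finset (Fin n))) f) v
  simpa [neighbourSum, pow_succ] using h

/-! ### Excess and its congruences -/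

/-- The indicator function of a code `C`. -/
def ind {n : ℕ} (C : Finset (Finset (Fin n))) (v : Finset (Fin n)) : ℕ := if v ∈ C then 1 else 0

/-- The number of times in excess of one that `v` is covered by `C`. -/
def excess {n : ℕ} (C : Finset (Finset (Fin n))) (v : Finset (Fin n)) : ℕ :=
  ballSum (ind C) v - 1

/-- Every vertex is covered by `C`. -/
def Covers {n : ℕ} (C : Finset (Finset (Fin n))) : Prop := ∀ v, 1 ≤ ballSum (ind C) v

variable {n : ℕ} {C : Finset (Finset (Fin n))}

theorem Covers.excess_add_one (hC : Covers C) (v : Finset (Fin n)) :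
    excess C v + 1 = ind C v + ∑ i, ind C (toggle v i) := by
  have := hC v
  unfold excess
  rw [← ballSum]
  omega

/-- With A the adjacency operator, e = (1+A)1_C - 1. Mod 2, A² = n = 0, so (1+A)e = 1_C - 1. -/
theorem Covers.ballSum_excess_odd (hC : Covers C) (hn : 2 ∣ n) (v : Finset (Fin n)) :
    (ballSum (excess C) v + ind C v) % 2 = 1 := by
  have hn0 : (n : ZMod 2) = 0 := (ZMod.natCast_eq_zero_iff n 2).2 hn
  have key : ∀ w, (excess C w : ZMod 2) = ind C w + ∑ i, (ind C (toggle w i) : ZMod 2) - 1 := by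
    intro w
    have := congrArg (Nat.cast : ℕ → ZMod 2) (hC.excess_add_one w)
    push_cast at this
    rw [← this]
    ring
  have h : ((ballSum (excess C) v + ind C v : ℕ) : ZMod 2) = (1 : ℕ) := by
    unfold ballSum
    push_cast
    simp only [key, sum_sub_distrib, sum_add_distrib, sum_const, card_univ, Fintype.card_fin,
      nsmul_eq_mul, hn0, zero_mul, sub_zero,
      sum_sum_toggle_mod_two (fun w => (ind C w : ZMod 2)) v]
    have h2 : (2 : ZMod 2) = 0 := rfl
    linear_combination ((ind C v : ZMod 2) + ∑ i, (ind C (toggle v i) : ZMod 2) - 1) * h2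
  exact (ZMod.natCast_eq_natCast_iff' _ _ 2).1 h

/-- Mod 3, A³ = A gives (2A+A²)(1+A) = 3A+3A² = 0, and 2A+A² kills constants because 3 ∣ n. -/
theorem Covers.three_dvd (hC : Covers C) (hn : 3 ∣ n) (v : Finset (Fin n)) :
    3 ∣ 2 * ∑ i, excess C (toggle v i) + ∑ i, ∑ j, excess C (toggle (toggle v i) j) := by
  have hn0 : (n : ZMod 3) = 0 := (ZMod.natCast_eq_zero_iff n 3).2 hn
  have key : ∀ w, (excess C w : ZMod 3) = ind C w + ∑ i, (ind C (toggle w i) : ZMod 3) - 1 := by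
    intro w
    have := congrArg (Nat.cast : ℕ → ZMod 3) (hC.excess_add_one w)
    push_cast at this
    rw [← this]
    ring
  rw [← ZMod.natCast_eq_zero_iff]
  push_cast
  simp only [key, sum_sub_distrib, sum_add_distrib, sum_const, card_univ, Fintype.card_fin,
    nsmul_eq_mul, hn0, zero_mul, sub_zero,
    sum_toggle_pow_three (fun w => (ind C w : ZMod 3)) v]
  have h3 : (3 : ZMod 3) = 0 := rfl
  linear_combination (∑ i, (ind C (toggle v i) : ZMod 3) +
    ∑ i, ∑ j, (ind C (toggle (toggle v i) j) : ZMod 3)) * h3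

/-! ### Charges -/

/-- The charge that a vertex sends to each vertex of excess one in its closed neighbourhood. -/
def charge {n : ℕ} (C : Finset (Finset (Fin n))) (v : Finset (Fin n)) : ℕ :=
  if v ∈ C then 0
  else if 2 ≤ excess C v ∨ ∃ i, 2 ≤ excess C (toggle v i) then 3
  else if 2 ≤ ballSum (excess C) v then 2
  else 0

/-- The directions in which the neighbour of `v` is a codeword. -/
def codeDirs {n : ℕ} (C : Finset (Finset (Fin n))) (v : Finset (Fin n)) : Finset (Fin n) :=
  {i | toggle v i ∈ C}

theorem mem_codeDirs {v : Finset (Fin n)} {i : Fin n} : i ∈ codeDirs C v ↔ toggle v i ∈ C := by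
  simp [codeDirs]

/-- The directions in which the neighbour of `v` has positive excess. -/
def excessDirs {n : ℕ} (C : Finset (Finset (Fin n))) (v : Finset (Fin n)) : Finset (Fin n) :=
  {i | 1 ≤ excess C (toggle v i)}

theorem mem_excessDirs {v : Finset (Fin n)} {i : Fin n} :
    i ∈ excessDirs C v ↔ 1 ≤ excess C (toggle v i) := by
  simp [excessDirs]

theorem sum_ind_toggle (v : Finset (Fin n)) : ∑ i, ind C (toggle v i) = #(codeDirs C v) := by
  simp [ind, codeDirs]

theorem Covers.excess_add_one_eq_card (hC : Covers C) (v : Finset (Fin n)) :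
    excess C v + 1 = ind C v + #(codeDirs C v) := by
  rw [← sum_ind_toggle, hC.excess_add_one]

theorem ind_le_one (v : Finset (Fin n)) : ind C v ≤ 1 := by
  unfold ind; split_ifs <;> simp

theorem ind_of_mem {v : Finset (Fin n)} (h : v ∈ C) : ind C v = 1 := if_pos h

theorem ind_of_notMem {v : Finset (Fin n)} (h : v ∉ C) : ind C v = 0 := if_neg h

theorem excess_pos_of_ne {v : Finset (Fin n)} {i j : Fin n} (hij : i ≠ j)
    (hi : toggle v i ∈ C) (hj : toggle v j ∈ C) : ind C v + 1 ≤ excess C v := by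
  have h1 := two_neighbours_le_ballSum (ind C) v hij
  rw [ind_of_mem hi, ind_of_mem hj] at h1
  unfold excess
  omega

theorem excess_pos_of_mem {v : Finset (Fin n)} {i : Fin n}
    (hv : v ∈ C) (hi : toggle v i ∈ C) : 1 ≤ excess C v := by
  have h1 := neighbour_le_ballSum (ind C) v i
  rw [ind_of_mem hi, ind_of_mem hv] at h1
  unfold excess
  omega

theorem charge_eq_three_of_self {v : Finset (Fin n)} (hv : v ∉ C) (h : 2 ≤ excess C v) :
    charge C v = 3 := by
  simp [charge, hv, h]

theorem charge_eq_three {v : Finset (Fin n)} {i : Fin n} (hv : v ∉ C)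
    (h : 2 ≤ excess C (toggle v i)) : charge C v = 3 := by
  have : ∃ i, 2 ≤ excess C (toggle v i) := ⟨i, h⟩
  simp [charge, hv, this]

theorem two_le_charge {v : Finset (Fin n)} (hv : v ∉ C)
    (h : 2 ≤ ballSum (excess C) v) : 2 ≤ charge C v := by
  unfold charge
  rw [if_neg hv]
  split_ifs <;> omega

theorem charge_le_sum {z : Finset (Fin n)} {P : Finset (Fin n)}
    (h : ∀ i ∈ P, 2 ≤ charge C (toggle z i)) :
    charge C z + 2 * #P ≤ ballSum (charge C) z := by
  have h1 : #P • 2 ≤ ∑ i ∈ P, charge C (toggle z i) := card_nsmul_le_sum P _ 2 h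
  have h2 : ∑ i ∈ P, charge C (toggle z i) ≤ ∑ i, charge C (toggle z i) :=
    sum_le_sum_of_subset (subset_univ _)
  unfold ballSum
  rw [smul_eq_mul] at h1
  omega

theorem charge_lt_sum {z : Finset (Fin n)} {P : Finset (Fin n)} {x : Fin n} (hx : x ∈ P)
    (h : ∀ i ∈ P, 2 ≤ charge C (toggle z i)) (h3 : charge C (toggle z x) = 3) :
    charge C z + 2 * #P + 1 ≤ ballSum (charge C) z := by
  have h1 : #(P.erase x) • 2 ≤ ∑ i ∈ P.erase x, charge C (toggle z i) :=
    card_nsmul_le_sum _ _ 2 fun i hi => h i (mem_of_mem_erase hi)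
  have h2 : ∑ i ∈ P, charge C (toggle z i) ≤ ∑ i, charge C (toggle z i) :=
    sum_le_sum_of_subset (subset_univ _)
  rw [← add_sum_erase _ _ hx, h3] at h2
  have := card_erase_add_one hx
  unfold ballSum
  rw [smul_eq_mul] at h1
  omega

theorem two_le_charge_toggle {z : Finset (Fin n)} {i j : Fin n} (hz : 1 ≤ excess C z)
    (hi : i ∉ codeDirs C z) (hij : i ≠ j) (h : 1 ≤ excess C (toggle (toggle z i) j)) :
    2 ≤ charge C (toggle z i) := by
  refine two_le_charge (fun h => hi (mem_codeDirs.2 h)) ?_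
  have := two_neighbours_le_ballSum (excess C) (toggle z i) hij
  rw [toggle_toggle] at this
  omega

theorem two_le_charge_of_mem_sdiff {z : Finset (Fin n)} (hz : 1 ≤ excess C z) {a : Fin n}
    (ha : a ∈ codeDirs C z) : ∀ i ∈ excessDirs C (toggle z a) \ codeDirs C z,
      2 ≤ charge C (toggle z i) := by
  intro i hi
  rw [mem_sdiff, mem_excessDirs, toggle_comm] at hi
  exact two_le_charge_toggle hz hi.2 (fun h => hi.2 (h ▸ ha)) hi.1

/-- If z+a+i has positive excess and z+i is not a codeword, then the ball of z+i contains both z and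
z+a+i, so z+i sends at least 2. -/
theorem card_excessDirs_le {z : Finset (Fin n)} (hz : 1 ≤ excess C z) {a : Fin n}
    (ha : a ∈ codeDirs C z) :
    charge C z + 2 * #(excessDirs C (toggle z a)) ≤
      ballSum (charge C) z + 2 * #(codeDirs C z) := by
  have h1 := charge_le_sum (two_le_charge_of_mem_sdiff hz ha)
  have h2 := le_card_sdiff (codeDirs C z) (excessDirs C (toggle z a))
  omega

theorem card_excessDirs_lt {z : Finset (Fin n)} (hz : 1 ≤ excess C z) {a x : Fin n}
    (ha : a ∈ codeDirs C z) (hx : x ∉ codeDirs C z)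
    (h : 2 ≤ excess C (toggle (toggle z a) x)) :
    charge C z + 2 * #(excessDirs C (toggle z a)) + 1 ≤
      ballSum (charge C) z + 2 * #(codeDirs C z) ∧ 3 ≤ ballSum (charge C) z := by
  have hc : charge C (toggle z x) = 3 :=
    charge_eq_three (i := a) (fun h => hx (mem_codeDirs.2 h)) (by rwa [toggle_comm])
  have hmem : x ∈ excessDirs C (toggle z a) \ codeDirs C z :=
    mem_sdiff.2 ⟨mem_excessDirs.2 (by omega), hx⟩
  have h1 := charge_lt_sum hmem (two_le_charge_of_mem_sdiff hz ha) hc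
  have h2 := le_card_sdiff (codeDirs C z) (excessDirs C (toggle z a))
  have h3 := card_pos.2 ⟨x, hmem⟩
  omega

theorem two_le_card_excessDirs {z : Finset (Fin n)} (hz : 1 ≤ excess C z) {a p : Fin n}
    (hp : p ≠ a) (h : 1 ≤ excess C (toggle (toggle z a) p)) :
    2 ≤ #(excessDirs C (toggle z a)) := by
  have : ({p, a} : Finset (Fin n)) ⊆ excessDirs C (toggle z a) := by
    intro i hi
    rw [mem_insert, mem_singleton] at hi
    rw [mem_excessDirs]
    rcases hi with rfl | rfl
    · exact h
    · rwa [toggle_toggle]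
  rw [← card_pair hp]
  exact card_le_card this

/-! ### Donations, and heavy vertices at distance two -/

/-- The donation sent through a codeword `c` to each neighbour of `c` with positive excess. -/
def share {n : ℕ} (C : Finset (Finset (Fin n))) (c : Finset (Fin n)) : ℕ :=
  6 / (#(excessDirs C c) - 1)

/-- The donation received by `z` from vertices of excess at least two through a codeword. -/
def remoteDonation {n : ℕ} (C : Finset (Finset (Fin n))) (z : Finset (Fin n)) : ℕ :=
  ∑ a, ∑ p, if toggle z a ∈ C ∧ p ≠ a ∧ 2 ≤ excess C (toggle (toggle z a) p)
    then share C (toggle z a) else 0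

/-- The donation received by a codeword `z` from neighbours of excess at least two. -/
def directDonation {n : ℕ} (C : Finset (Finset (Fin n))) (z : Finset (Fin n)) : ℕ :=
  ∑ a, if z ∈ C ∧ 2 ≤ excess C (toggle z a) then (if toggle z a ∈ C then 4 else 1) else 0

theorem sum_share_le {z : Finset (Fin n)} {S : Finset (Fin n)} {t : Fin n → Fin n}
    (h : ∀ a ∈ S, toggle z a ∈ C ∧ t a ≠ a ∧ 2 ≤ excess C (toggle (toggle z a) (t a))) :
    ∑ a ∈ S, share C (toggle z a) ≤ remoteDonation C z := by
  refine le_trans (sum_le_sum fun a ha => ?_) (sum_le_sum_of_subset (subset_univ S))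
  refine le_trans (le_of_eq ?_) (single_le_sum (fun _ _ => Nat.zero_le _) (mem_univ (t a)))
  rw [if_pos (h a ha)]

theorem le_directDonation {z : Finset (Fin n)} {a : Fin n} (hz : z ∈ C)
    (h : 2 ≤ excess C (toggle z a)) :
    (if toggle z a ∈ C then 4 else 1) ≤ directDonation C z := by
  have := single_le_sum (f := fun a => if z ∈ C ∧ 2 ≤ excess C (toggle z a) then
    (if toggle z a ∈ C then 4 else 1) else 0) (fun _ _ => Nat.zero_le _) (mem_univ a)
  refine le_trans (le_of_eq ?_) this
  simp only [hz, h, and_self, if_true]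

/-- Charges and shares trade off: if a codeword between z and the heavy vertex has k neighbours of
positive excess, its share is ⌊6/(k-1)⌋ while z receives charge at least 2(k-2). Only k = l = 3
needs both shares. -/
theorem six_le_of_heavy_code_code {z : Finset (Fin n)} (hz : 1 ≤ excess C z)
    (hs : #(codeDirs C z) ≤ 2) {a b : Fin n} (ha : a ∈ codeDirs C z) (hb : b ∈ codeDirs C z)
    (hab : a ≠ b) (h : 2 ≤ excess C (toggle (toggle z a) b)) :
    6 ≤ ballSum (charge C) z + remoteDonation C z := by
  have h1 := card_excessDirs_le hz ha
  have h2 := card_excessDirs_le hz hb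
  have h3 := two_le_card_excessDirs hz hab.symm (by omega : 1 ≤ excess C (toggle (toggle z a) b))
  have h4 := two_le_card_excessDirs hz hab (by rw [toggle_comm]; omega)
  have h5 := sum_share_le (C := C) (z := z) (S := {a, b}) (t := fun i => if i = a then b else a) (by
    intro i hi
    rw [mem_insert, mem_singleton] at hi
    rcases hi with rfl | rfl
    · exact ⟨mem_codeDirs.1 ha, by simp [hab.symm], by simpa using h⟩
    · exact ⟨mem_codeDirs.1 hb, by simp [hab.symm, hab], by
        simp only [hab.symm, if_false]; rwa [toggle_comm]⟩)
  rw [sum_pair hab] at h5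
  unfold share at h5
  generalize #(excessDirs C (toggle z a)) = k at *
  generalize #(excessDirs C (toggle z b)) = l at *
  by_cases hk : k < 5
  · by_cases hl : l < 5
    · interval_cases k <;> interval_cases l <;> omega
    · omega
  · omega

/-- There is one share only, but z+x sends 3 rather than 2, and that extra unit settles k = 3 and k
= 4. -/
theorem six_le_of_heavy_code_noncode {z : Finset (Fin n)} (hz : 1 ≤ excess C z)
    (hs : #(codeDirs C z) ≤ 2) {a x : Fin n} (ha : a ∈ codeDirs C z) (hx : x ∉ codeDirs C z)
    (h : 2 ≤ excess C (toggle (toggle z a) x)) :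
    6 ≤ ballSum (charge C) z + remoteDonation C z := by
  have hxa : x ≠ a := fun e => hx (e ▸ ha)
  have h1 := card_excessDirs_lt hz ha hx h
  have h3 := two_le_card_excessDirs hz hxa (by omega : 1 ≤ excess C (toggle (toggle z a) x))
  have h5 := sum_share_le (C := C) (z := z) (S := {a}) (t := fun _ => x) (by
    intro i hi
    rw [mem_singleton] at hi
    subst hi
    exact ⟨mem_codeDirs.1 ha, hxa, h⟩)
  rw [sum_singleton] at h5
  unfold share at h5
  generalize #(excessDirs C (toggle z a)) = k at *
  by_cases hk : k < 5
  · interval_cases k <;> omega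
  · omega

theorem six_le_of_heavy_noncode_noncode {z : Finset (Fin n)} {x y : Fin n}
    (hx : x ∉ codeDirs C z) (hy : y ∉ codeDirs C z)
    (hxy : x ≠ y) (h : 2 ≤ excess C (toggle (toggle z x) y)) :
    6 ≤ ballSum (charge C) z := by
  have h1 : charge C (toggle z x) = 3 := charge_eq_three (fun h => hx (mem_codeDirs.2 h)) h
  have h2 : charge C (toggle z y) = 3 :=
    charge_eq_three (i := x) (fun h => hy (mem_codeDirs.2 h)) (by rwa [toggle_comm])
  have := two_neighbours_le_ballSum (charge C) z hxy
  omega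

theorem six_le_of_heavy_at_distance_two {z : Finset (Fin n)} (hz : 1 ≤ excess C z)
    (hs : #(codeDirs C z) ≤ 2) {i j : Fin n} (hij : i ≠ j)
    (h : 2 ≤ excess C (toggle (toggle z i) j)) :
    6 ≤ ballSum (charge C) z + remoteDonation C z := by
  by_cases hi : i ∈ codeDirs C z
  · by_cases hj : j ∈ codeDirs C z
    · exact six_le_of_heavy_code_code hz hs hi hj hij h
    · exact six_le_of_heavy_code_noncode hz hs hi hj h
  · by_cases hj : j ∈ codeDirs C z
    · exact six_le_of_heavy_code_noncode hz hs hj hi (by rwa [toggle_comm])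
    · exact (six_le_of_heavy_noncode_noncode hi hj hij h).trans (Nat.le_add_right _ _)

/-! ### Heavy neighbours -/

/-- A heavy neighbour of a noncodeword `z` of excess one, all vertices at distance two being
light. -/
theorem Covers.six_le_of_heavy_neighbour_of_notMem (hC : Covers C) {z : Finset (Fin n)}
    (hzC : z ∉ C) (hz : excess C z = 1)
    (hlight : ∀ i j, i ≠ j → excess C (toggle (toggle z i) j) ≤ 1) {a : Fin n}
    (h : 2 ≤ excess C (toggle z a)) : 6 ≤ ballSum (charge C) z := by
  have h0 : charge C z = 3 := charge_eq_three hzC h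
  have hcard := hC.excess_add_one_eq_card z
  rw [ind_of_notMem hzC, hz] at hcard
  by_cases ha : a ∈ codeDirs C z
  · have hcard' := hC.excess_add_one_eq_card (toggle z a)
    rw [ind_of_mem (mem_codeDirs.1 ha)] at hcard'
    have hP : ∀ p ∈ codeDirs C (toggle z a), p ≠ a ∧ p ∉ codeDirs C z := by
      intro p hp
      rw [mem_codeDirs] at hp
      have hpa : p ≠ a := by
        rintro rfl
        rw [toggle_toggle] at hp
        exact hzC hp
      refine ⟨hpa, fun hpz => ?_⟩
      -- Otherwise z+a+p would be a codeword with two codeword neighbours, hence heavy at distance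
      -- two.
      have h1 := excess_pos_of_ne (v := toggle (toggle z a) p) (i := p) (j := a) hpa
        (by rw [toggle_toggle]; exact mem_codeDirs.1 ha)
        (by rw [toggle_comm z, toggle_toggle]; exact mem_codeDirs.1 hpz)
      rw [ind_of_mem hp] at h1
      have := hlight a p hpa.symm
      omega
    have := charge_le_sum (C := C) (z := z) (P := codeDirs C (toggle z a)) (by
      intro p hp
      refine two_le_charge_toggle hz.ge (hP p hp).2 (hP p hp).1 ?_
      rw [mem_codeDirs] at hp
      rw [toggle_comm]
      exact excess_pos_of_mem (i := p) hp
        (by rw [toggle_toggle]; exact mem_codeDirs.1 ha))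
    omega
  · have h1 := charge_eq_three_of_self (fun h => ha (mem_codeDirs.2 h)) h
    have := neighbour_le_ballSum (charge C) z a
    omega

/-- The direct donations are fitted here: a heavy codeword gives 4 and some z+p sends 2; a heavy
noncodeword gives 1, sends 3, and some z+p sends 2. -/
theorem Covers.six_le_of_heavy_neighbour_of_mem (hC : Covers C) {z : Finset (Fin n)}
    (hzC : z ∈ C) (hz : excess C z = 1) {a : Fin n}
    (h : 2 ≤ excess C (toggle z a)) : 6 ≤ ballSum (charge C) z + directDonation C z := by
  have hd := le_directDonation hzC h
  have hcard := hC.excess_add_one_eq_card z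
  rw [ind_of_mem hzC, hz] at hcard
  have hcard' := hC.excess_add_one_eq_card (toggle z a)
  obtain ⟨b, hb⟩ := card_eq_one.1 (by omega : #(codeDirs C z) = 1)
  by_cases ha : toggle z a ∈ C
  · rw [ind_of_mem ha] at hcard'
    rw [if_pos ha] at hd
    have hab : a = b := by
      have := mem_codeDirs.2 ha
      rwa [hb, mem_singleton] at this
    subst hab
    obtain ⟨p, hp, hpa⟩ := exists_mem_ne (by omega : 1 < #(codeDirs C (toggle z a))) a
    rw [mem_codeDirs] at hp
    have h1 : 2 ≤ charge C (toggle z p) := by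
      refine two_le_charge_toggle hz.ge (by rw [hb, mem_singleton]; exact hpa) hpa ?_
      rw [toggle_comm]
      exact excess_pos_of_mem (i := p) hp (by rwa [toggle_toggle])
    have := neighbour_le_ballSum (charge C) z p
    omega
  · rw [ind_of_notMem ha] at hcard'
    rw [if_neg ha] at hd
    have hab : a ≠ b := by
      rintro rfl
      exact ha (mem_codeDirs.1 (by simp [hb]))
    have h3 := charge_eq_three_of_self ha h
    obtain ⟨p, hp, hpa⟩ : ∃ p ∈ (codeDirs C (toggle z a)).erase a, p ≠ b := by
      refine exists_mem_ne ?_ b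
      have := pred_card_le_card_erase (s := codeDirs C (toggle z a)) (a := a)
      omega
    rw [mem_erase, mem_codeDirs] at hp
    have hpC : toggle z p ∉ C := fun h => hpa (by
      have := mem_codeDirs.2 h
      rwa [hb, mem_singleton] at this)
    have h1 : 2 ≤ charge C (toggle z p) := by
      refine two_le_charge hpC ?_
      have h4 := excess_pos_of_ne (v := toggle z p) (i := p) (j := a) hp.1
        (by rwa [toggle_toggle]) (by rw [toggle_comm]; exact hp.2)
      have := neighbour_le_ballSum (excess C) (toggle z p) p
      rw [toggle_toggle] at this
      omega
    have := two_neighbours_le_ballSum (charge C) z hp.1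
    omega

/-! ### Light surroundings: the parity and mod 3 contradiction -/

theorem exists_pair_of_card_le_two {P s : Finset (Fin n)} (hP : #P ≤ 2) (hPs : Disjoint P s)
    (hn : #s + 2 ≤ n) :
    ∃ x y, x ≠ y ∧ x ∉ s ∧ y ∉ s ∧ ∀ i ∈ P, i = x ∨ i = y := by
  obtain ⟨Q, hPQ, hQs, hQ⟩ := exists_subsuperset_card_eq
    (show P ⊆ sᶜ from subset_compl_iff_disjoint_right.2 hPs) hP
    (by rw [card_compl, Fintype.card_fin]; omega)
  obtain ⟨x, y, hxy, rfl⟩ := card_eq_two.1 hQ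
  refine ⟨x, y, hxy, ?_, ?_, fun i hi => by simpa using hPQ hi⟩
  · simpa using hQs (mem_insert_self x {y})
  · simpa using hQs (mem_insert_of_mem (mem_singleton_self y))

/-- The variables are the excesses at z+i (`ha`, ...) and z+i+j (`ab`, ...). Parity determines the
first kind from the second, leaving 32 cases. -/
theorem no_light_noncode_pattern (ha hb hx hy ab ax ay bx bY xy : ℕ)
    (la : ha ≤ 1) (lb : hb ≤ 1) (lx : hx ≤ 1) (ly : hy ≤ 1) (lab : ab = 1) (lax : ax ≤ 1)
    (lay : ay ≤ 1) (lbx : bx ≤ 1) (lby : bY ≤ 1) (lxy : xy ≤ 1)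
    (pa : (ha + ab + ax + ay) % 2 = 1)
    (pb : (hb + ab + bx + bY) % 2 = 1) (px : (hx + ax + bx + xy) % 2 = 0)
    (py : (hy + ay + bY + xy) % 2 = 0)
    (few : ha + hb + hx + hy = 0 ∨ hx + ax + bx + xy = 0 ∨ hy + ay + bY + xy = 0)
    (three : 3 ∣ ha + hb + hx + hy + (ab + ax + ay + bx + bY + xy)) : False := by
  subst lab
  obtain rfl : ha = (ax + ay) % 2 := by clear few three; omega
  obtain rfl : hb = (bx + bY) % 2 := by clear few three; omega
  obtain rfl : hx = (ax + bx + xy) % 2 := by clear few three; omega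
  obtain rfl : hy = (ay + bY + xy) % 2 := by clear few three; omega
  have key : ∀ ax ay bx bY xy : Fin 2,
      ((ax + ay : ℕ) % 2 + (bx + bY : ℕ) % 2 + (ax + bx + xy : ℕ) % 2 + (ay + bY + xy : ℕ) % 2 = 0 ∨
        (ax + bx + xy : ℕ) % 2 + ax + bx + xy = 0 ∨ (ay + bY + xy : ℕ) % 2 + ay + bY + xy = 0) →
      ¬ 3 ∣ (ax + ay : ℕ) % 2 + (bx + bY : ℕ) % 2 + (ax + bx + xy : ℕ) % 2 +
        (ay + bY + xy : ℕ) % 2 + (1 + ax + ay + bx + bY + xy) := by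
    decide
  exact key ⟨ax, Nat.lt_succ_of_le lax⟩ ⟨ay, Nat.lt_succ_of_le lay⟩ ⟨bx, Nat.lt_succ_of_le lbx⟩
    ⟨bY, Nat.lt_succ_of_le lby⟩ ⟨xy, Nat.lt_succ_of_le lxy⟩ few three

theorem no_light_code_pattern (ha hx hy ax ay xy : ℕ)
    (la : ha = 1) (lx : hx ≤ 1) (ly : hy ≤ 1) (lax : ax ≤ 1)
    (lay : ay ≤ 1) (lxy : xy ≤ 1)
    (p0 : (ha + hx + hy) % 2 = 1) (pa : (ha + ax + ay) % 2 = 1)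
    (px : (hx + ax + xy) % 2 = 0) (py : (hy + ay + xy) % 2 = 0)
    (three : 3 ∣ ha + hx + hy + (ax + ay + xy)) : False := by
  rcases (by omega : ax = 0 ∨ ax = 1) with rfl | rfl <;>
  rcases (by omega : ay = 0 ∨ ay = 1) with rfl | rfl <;>
  rcases (by omega : xy = 0 ∨ xy = 1) with rfl | rfl <;> omega

/-- Neighbourhood sums around `z` when all positive excess at distance one and two from `z` lies in
the directions `T`. -/
theorem sums_of_support {z : Finset (Fin n)} {T : Finset (Fin n)} (hz : excess C z = 1)
    (h1 : ∀ i ∉ T, excess C (toggle z i) = 0)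
    (h2 : ∀ i ∉ T, ∀ j, i ≠ j → excess C (toggle (toggle z i) j) = 0) :
    ballSum (excess C) z = 1 + ∑ i ∈ T, excess C (toggle z i) ∧
    (∀ i, ballSum (excess C) (toggle z i) =
      excess C (toggle z i) + 1 + ∑ j ∈ T.erase i, excess C (toggle (toggle z i) j)) ∧
    ∑ i, ∑ j, excess C (toggle (toggle z i) j) =
      n + ∑ i ∈ T, ∑ j ∈ T.erase i, excess C (toggle (toggle z i) j) := by
  have hrow : ∀ i, ∑ j, excess C (toggle (toggle z i) j) =
      1 + ∑ j ∈ T.erase i, excess C (toggle (toggle z i) j) := by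
    intro i
    rw [← add_sum_erase _ _ (mem_univ i), toggle_toggle, hz]
    congr 1
    symm
    refine sum_subset (erase_subset_erase _ (subset_univ _)) fun j hj hj' => ?_
    have hji := ne_of_mem_erase hj
    rw [toggle_comm]
    exact h2 j (fun h => hj' (mem_erase.2 ⟨hji, h⟩)) i hji
  refine ⟨?_, fun i => ?_, ?_⟩
  · rw [ballSum, hz]
    congr 1
    exact (sum_subset (subset_univ _) fun i _ hi => h1 i hi).symm
  · rw [ballSum, hrow, add_assoc]
  · simp only [hrow, sum_add_distrib, sum_const, card_univ, Fintype.card_fin, smul_eq_mul, mul_one]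
    congr 1
    symm
    refine sum_subset (subset_univ _) fun i _ hi => sum_eq_zero fun j hj => ?_
    exact h2 i hi j (ne_of_mem_erase hj).symm

theorem Covers.six_le_of_light (hC : Covers C) (hn : 6 ∣ n) (hn4 : 4 ≤ n)
    {z : Finset (Fin n)} (hz : excess C z = 1)
    (h1 : ∀ i, excess C (toggle z i) ≤ 1)
    (h2 : ∀ i j, i ≠ j → excess C (toggle (toggle z i) j) ≤ 1) :
    6 ≤ ballSum (charge C) z := by
  by_contra! hlt
  have hcard := hC.excess_add_one_eq_card z
  rw [hz] at hcard
  have hind := ind_le_one (C := C) z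
  have hn2 : 2 ∣ n := (by norm_num : 2 ∣ 6).trans hn
  have hn3 : 3 ∣ n := (by norm_num : 3 ∣ 6).trans hn
  have odd0 := hC.ballSum_excess_odd hn2 z
  have odd1 := fun i => hC.ballSum_excess_odd hn2 (toggle z i)
  have mod3 := hC.three_dvd hn3 z
  set P : Finset (Fin n) :=
    {i | i ∉ codeDirs C z ∧ 2 ≤ ballSum (excess C) (toggle z i)} with hPdef
  have hmemP : ∀ i, i ∈ P ↔ i ∉ codeDirs C z ∧ 2 ≤ ballSum (excess C) (toggle z i) := by
    simp [hPdef]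
  have hP := charge_le_sum (C := C) (z := z) (P := P) fun i hi =>
    two_le_charge (fun h => ((hmemP i).1 hi).1 (mem_codeDirs.2 h)) ((hmemP i).1 hi).2
  -- Each direction in `P` contributes at least 2, so a total below 6 allows at most two; they are
  -- padded to exactly two directions outside `codeDirs C z`.
  obtain ⟨x, y, hxy, hxs, hys, hPxy⟩ := exists_pair_of_card_le_two (P := P) (s := codeDirs C z)
    (by omega) (disjoint_left.2 fun i hi => ((hmemP i).1 hi).1) (by omega)
  have hout : ∀ i ∉ codeDirs C z, i ≠ x → i ≠ y → excess C (toggle z i) = 0 ∧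
      ∀ j, i ≠ j → excess C (toggle (toggle z i) j) = 0 := by
    intro i hi hix hiy
    have hiP : ¬ 2 ≤ ballSum (excess C) (toggle z i) := fun h =>
      (hPxy i ((hmemP i).2 ⟨hi, h⟩)).elim hix hiy
    have h3 := neighbour_le_ballSum (excess C) (toggle z i) i
    rw [toggle_toggle] at h3
    refine ⟨by omega, fun j hij => ?_⟩
    have h4 := two_neighbours_le_ballSum (excess C) (toggle z i) hij
    rw [toggle_toggle] at h4
    omega
  by_cases hzC : z ∈ C
  · rw [ind_of_mem hzC] at hcard odd0
    obtain ⟨a, hs⟩ := card_eq_one.1 (by omega : #(codeDirs C z) = 1)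
    have haC : toggle z a ∈ C := mem_codeDirs.1 (by simp [hs])
    rw [hs, mem_singleton] at hxs hys
    have hT : ∀ i ∉ ({a, x, y} : Finset (Fin n)), excess C (toggle z i) = 0 ∧
        ∀ j, i ≠ j → excess C (toggle (toggle z i) j) = 0 := by
      intro i hi
      simp only [mem_insert, mem_singleton, not_or] at hi
      exact hout i (by simp [hs, hi.1]) hi.2.1 hi.2.2
    obtain ⟨e0, e1, e2⟩ := sums_of_support hz (fun i hi => (hT i hi).1) (fun i hi => (hT i hi).2)
    have ia := odd1 a
    have ix := odd1 x
    have iy := odd1 y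
    rw [ind_of_mem haC] at ia
    rw [ind_of_notMem (fun h => hxs (by simpa [hs] using mem_codeDirs.2 h))] at ix
    rw [ind_of_notMem (fun h => hys (by simpa [hs] using mem_codeDirs.2 h))] at iy
    have ea : ({a, x, y} : Finset (Fin n)).erase a = {x, y} := by grind
    have ex : ({a, x, y} : Finset (Fin n)).erase x = {a, y} := by grind
    have ey : ({a, x, y} : Finset (Fin n)).erase y = {a, x} := by grind
    have hT3 : ∀ g : Fin n → ℕ, ∑ i ∈ ({a, x, y} : Finset (Fin n)), g i = g a + g x + g y := by
      intro g
      rw [sum_insert (by simp [Ne.symm hxs, Ne.symm hys]), sum_pair hxy, add_assoc]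
    have e3 : ∑ i, excess C (toggle z i) = ∑ i ∈ ({a, x, y} : Finset (Fin n)),
      excess C (toggle z i) := (sum_subset (subset_univ _) fun i _ hi => (hT i hi).1).symm
    rw [e1, ea, sum_pair hxy] at ia
    rw [e1, ex, sum_pair (Ne.symm hys)] at ix
    rw [e1, ey, sum_pair (Ne.symm hxs)] at iy
    rw [e0, hT3] at odd0
    rw [e2, e3, hT3, hT3, ea, ex, ey, sum_pair hxy, sum_pair (Ne.symm hys),
      sum_pair (Ne.symm hxs)] at mod3
    rw [toggle_comm z x a] at ix mod3
    rw [toggle_comm z y a, toggle_comm z y x] at iy mod3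
    -- z and z+a are adjacent codewords, so the excess at z+a is exactly one.
    have ha1 := excess_pos_of_mem (i := a) haC (by rwa [toggle_toggle])
    have := h1 a
    refine no_light_code_pattern (excess C (toggle z a)) _ _ _ _ _ (by omega) (h1 x) (h1 y) (h2 a x (Ne.symm hxs))
      (h2 a y (Ne.symm hys)) (h2 x y hxy) ?_ ?_ ?_ ?_ ?_ <;> omega
  · rw [ind_of_notMem hzC] at hcard odd0
    obtain ⟨a, b, hab, hs⟩ := card_eq_two.1 (by omega : #(codeDirs C z) = 2)
    have haC : toggle z a ∈ C := mem_codeDirs.1 (by simp [hs])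
    have hbC : toggle z b ∈ C := mem_codeDirs.1 (by simp [hs])
    have hxC : toggle z x ∉ C := fun h => hxs (mem_codeDirs.2 h)
    have hyC : toggle z y ∉ C := fun h => hys (mem_codeDirs.2 h)
    -- Otherwise the noncodewords z, z+x and z+y would each send at least 2 to z.
    have hfew : ballSum (excess C) z < 2 ∨ ballSum (excess C) (toggle z x) < 2 ∨
        ballSum (excess C) (toggle z y) < 2 := by
      by_contra! h
      have h3 := two_le_charge hzC h.1
      have h4 := two_le_charge hxC h.2.1
      have h5 := two_le_charge hyC h.2.2
      have := two_neighbours_le_ballSum (charge C) z hxy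
      omega
    rw [hs, mem_insert, mem_singleton, not_or] at hxs hys
    have hT : ∀ i ∉ ({a, b, x, y} : Finset (Fin n)), excess C (toggle z i) = 0 ∧
        ∀ j, i ≠ j → excess C (toggle (toggle z i) j) = 0 := by
      intro i hi
      simp only [mem_insert, mem_singleton, not_or] at hi
      exact hout i (by simp [hs, hi.1, hi.2.1]) hi.2.2.1 hi.2.2.2
    obtain ⟨e0, e1, e2⟩ := sums_of_support hz (fun i hi => (hT i hi).1) (fun i hi => (hT i hi).2)
    have ia := odd1 a
    have ib := odd1 b
    have ix := odd1 x
    have iy := odd1 y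
    rw [ind_of_mem haC] at ia
    rw [ind_of_mem hbC] at ib
    rw [ind_of_notMem hxC] at ix
    rw [ind_of_notMem hyC] at iy
    have ea : ({a, b, x, y} : Finset (Fin n)).erase a = {b, x, y} := by grind
    have eb : ({a, b, x, y} : Finset (Fin n)).erase b = {a, x, y} := by grind
    have ex : ({a, b, x, y} : Finset (Fin n)).erase x = {a, b, y} := by grind
    have ey : ({a, b, x, y} : Finset (Fin n)).erase y = {a, b, x} := by grind
    have hsum3 : ∀ (g : Fin n → ℕ) {i j k : Fin n}, i ≠ j → i ≠ k → j ≠ k →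
        ∑ l ∈ ({i, j, k} : Finset (Fin n)), g l = g i + g j + g k := by
      intro g i j k hij hik hjk
      rw [sum_insert (by simp [hij, hik]), sum_pair hjk, add_assoc]
    have hT4 : ∀ g : Fin n → ℕ, ∑ i ∈ ({a, b, x, y} : Finset (Fin n)), g i =
        g a + g b + g x + g y := by
      intro g
      rw [sum_insert (by simp [hab, Ne.symm hxs.1, Ne.symm hys.1]),
        hsum3 g (Ne.symm hxs.2) (Ne.symm hys.2) hxy]
      ring
    have e3 : ∑ i, excess C (toggle z i) = ∑ i ∈ ({a, b, x, y} : Finset (Fin n)),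
      excess C (toggle z i) := (sum_subset (subset_univ _) fun i _ hi => (hT i hi).1).symm
    have sa := fun g => hsum3 g (Ne.symm hxs.2) (Ne.symm hys.2) hxy
    have sb := fun g => hsum3 g (Ne.symm hxs.1) (Ne.symm hys.1) hxy
    have sx := fun g => hsum3 g hab (Ne.symm hys.1) (Ne.symm hys.2)
    have sy := fun g => hsum3 g hab (Ne.symm hxs.1) (Ne.symm hxs.2)
    rw [e1, ea, sa] at ia
    rw [e1, eb, sb] at ib
    rw [e1, ex, sx] at ix
    rw [e1, ey, sy] at iy
    rw [e0, hT4] at odd0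
    rw [e0, e1, e1, ex, ey, hT4, sx, sy] at hfew
    rw [e2, e3, hT4, hT4, ea, eb, ex, ey, sa, sb, sx, sy] at mod3
    rw [toggle_comm z b a] at ib mod3
    rw [toggle_comm z x a, toggle_comm z x b] at ix mod3 hfew
    rw [toggle_comm z y a, toggle_comm z y b, toggle_comm z y x] at iy mod3 hfew
    -- z+a+b is adjacent to the codewords z+a and z+b, so its excess is exactly one.
    have hab1 := excess_pos_of_ne (v := toggle (toggle z a) b) (C := C) hab
      (by rwa [toggle_comm z, toggle_toggle]) (by rwa [toggle_toggle])
    have := h2 a b hab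
    refine no_light_noncode_pattern _ _ _ _ (excess C (toggle (toggle z a) b)) _ _ _ _ _ (h1 a) (h1 b) (h1 x) (h1 y) (by omega)
      (h2 a x (Ne.symm hxs.1)) (h2 a y (Ne.symm hys.1)) (h2 b x (Ne.symm hxs.2))
      (h2 b y (Ne.symm hys.2)) (h2 x y hxy) ?_ ?_ ?_ ?_ ?_ ?_ <;> omega

theorem Covers.six_le_charge_add_donation (hC : Covers C) (hn : 6 ∣ n) (hn4 : 4 ≤ n)
    {z : Finset (Fin n)} (hz : excess C z = 1) :
    6 ≤ ballSum (charge C) z + (remoteDonation C z + directDonation C z) := by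
  have hcard := hC.excess_add_one_eq_card z
  by_cases h2 : ∀ i j, i ≠ j → excess C (toggle (toggle z i) j) ≤ 1
  · by_cases h1 : ∀ i, excess C (toggle z i) ≤ 1
    · have := hC.six_le_of_light hn hn4 hz h1 h2
      omega
    · push Not at h1
      obtain ⟨i, hi⟩ := h1
      by_cases hzC : z ∈ C
      · have := hC.six_le_of_heavy_neighbour_of_mem hzC hz hi
        omega
      · have := hC.six_le_of_heavy_neighbour_of_notMem hzC hz h2 hi
        omega
  · push Not at h2
    obtain ⟨i, j, hij, h⟩ := h2
    have := six_le_of_heavy_at_distance_two hz.ge (by omega) hij h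
    omega

/-! ### Total donations -/

theorem sum_ite_eq_card_mul {ι : Type*} {s : Finset ι} {p : ι → Prop} [DecidablePred p] {k : ℕ} :
    ∑ i ∈ s, (if p i then k else 0) = #{i ∈ s | p i} * k := by
  rw [← sum_filter, sum_const, smul_eq_mul]

/-- A vertex of excess at least two sends at most `6` through each of its neighbouring
codewords. -/
theorem sum_remoteDonation_le :
    ∑ z, (if excess C z = 1 then remoteDonation C z else 0) ≤
      ∑ u, if 2 ≤ excess C u then 6 * #(codeDirs C u) else 0 := by
  calc ∑ z, (if excess C z = 1 then remoteDonation C z else 0)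
      = ∑ a, ∑ z, ∑ p, (if excess C z = 1 ∧ toggle z a ∈ C ∧ p ≠ a ∧
          2 ≤ excess C (toggle (toggle z a) p) then share C (toggle z a) else 0) := by
        rw [sum_comm]
        refine sum_congr rfl fun z _ => ?_
        by_cases h : excess C z = 1 <;> simp [h, remoteDonation]
    _ = ∑ a, ∑ c, ∑ p, (if excess C (toggle c a) = 1 ∧ c ∈ C ∧ p ≠ a ∧
          2 ≤ excess C (toggle c p) then share C c else 0) := by
        refine sum_congr rfl fun a _ => ?_
        rw [← sum_toggle _ a]
        simp only [toggle_toggle]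
    _ = ∑ p, ∑ c, ∑ a, (if excess C (toggle c a) = 1 ∧ c ∈ C ∧ p ≠ a ∧
          2 ≤ excess C (toggle c p) then share C c else 0) := by
        rw [sum_comm]
        conv_rhs => rw [sum_comm]
        exact sum_congr rfl fun c _ => sum_comm
    -- The heavy vertex c+p is itself among the neighbours of c with positive excess, so at most
    -- `#(excessDirs C c) - 1` shares are paid.
    _ ≤ ∑ p, ∑ c, (if c ∈ C ∧ 2 ≤ excess C (toggle c p) then 6 else 0) := by
        refine sum_le_sum fun p _ => sum_le_sum fun c _ => ?_
        by_cases h : c ∈ C ∧ 2 ≤ excess C (toggle c p)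
        · rw [if_pos h]
          have hp : p ∈ excessDirs C c := mem_excessDirs.2 (by omega)
          calc _ ≤ ∑ a ∈ (excessDirs C c).erase p, share C c := by
                rw [← sum_filter]
                refine sum_le_sum_of_subset fun a ha => ?_
                simp only [mem_filter, mem_univ, true_and] at ha
                exact mem_erase.2 ⟨ha.2.2.1.symm, mem_excessDirs.2 ha.1.ge⟩
            _ ≤ 6 := by
                rw [sum_const, card_erase_of_mem hp, smul_eq_mul]
                exact Nat.mul_div_le 6 _
        · rw [if_neg h]
          exact (sum_eq_zero fun a _ => if_neg fun h' => h ⟨h'.2.1, h'.2.2.2⟩).le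
    _ = ∑ p, ∑ u, (if toggle u p ∈ C ∧ 2 ≤ excess C u then 6 else 0) := by
        refine sum_congr rfl fun p _ => ?_
        rw [← sum_toggle _ p]
        simp only [toggle_toggle]
    _ = _ := by
        rw [sum_comm]
        refine sum_congr rfl fun u _ => ?_
        by_cases h : 2 ≤ excess C u
        · simp [h, codeDirs, sum_ite_eq_card_mul, mul_comm]
        · simp [h]

theorem sum_directDonation_le :
    ∑ z, (if excess C z = 1 then directDonation C z else 0) ≤
      ∑ u, if 2 ≤ excess C u then (if u ∈ C then 4 else 1) * #(codeDirs C u) else 0 := by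
  calc ∑ z, (if excess C z = 1 then directDonation C z else 0)
      ≤ ∑ z, ∑ a, (if z ∈ C ∧ 2 ≤ excess C (toggle z a) then
          (if toggle z a ∈ C then 4 else 1) else 0) := by
        refine sum_le_sum fun z _ => ?_
        split_ifs
        · exact le_rfl
        · exact Nat.zero_le _
    _ = ∑ a, ∑ u, (if toggle u a ∈ C ∧ 2 ≤ excess C u then (if u ∈ C then 4 else 1) else 0) := by
        rw [sum_comm]
        refine sum_congr rfl fun a _ => ?_
        rw [← sum_toggle _ a]
        simp only [toggle_toggle]
    _ = _ := by
        rw [sum_comm]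
        refine sum_congr rfl fun u _ => ?_
        by_cases h : 2 ≤ excess C u
        · simp [h, codeDirs, sum_ite_eq_card_mul, mul_comm]
        · simp [h]

/-! ### Balancing the charges and the global count -/

/-- The part of the excess of `v` that is charged at `v` when `v` has excess at least two. -/
def heavyExcess {n : ℕ} (C : Finset (Finset (Fin n))) (v : Finset (Fin n)) : ℕ :=
  if 2 ≤ excess C v then 3 * (excess C v - 1) else 0

/-- The indicator function of the vertices of excess one. -/
def light {n : ℕ} (C : Finset (Finset (Fin n))) (v : Finset (Fin n)) : ℕ :=
  if excess C v = 1 then 1 else 0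

theorem ballSum_add (f g : Finset (Fin n) → ℕ) (v : Finset (Fin n)) :
    ballSum (fun w => f w + g w) v = ballSum f v + ballSum g v := by
  simp only [ballSum, sum_add_distrib]
  ring

theorem ballSum_const_mul (k : ℕ) (f : Finset (Fin n) → ℕ) (v : Finset (Fin n)) :
    ballSum (fun w => k * f w) v = k * ballSum f v := by
  simp only [ballSum, mul_add, mul_sum]

theorem le_ballSum_of_heavy {f g : Finset (Fin n) → ℕ} {k : ℕ} (h : ∀ w, f w ≤ g w)
    {v : Finset (Fin n)} (hv : f v + k ≤ g v ∨ ∃ i, f (toggle v i) + k ≤ g (toggle v i)) :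
    ballSum f v + k ≤ ballSum g v := by
  unfold ballSum
  rcases hv with hv | ⟨i, hi⟩
  · have : ∑ i, f (toggle v i) ≤ ∑ i, g (toggle v i) := sum_le_sum fun i _ => h _
    omega
  · have : ∑ j ∈ univ.erase i, f (toggle v j) ≤ ∑ j ∈ univ.erase i, g (toggle v j) :=
      sum_le_sum fun i _ => h _
    have := h v
    rw [← add_sum_erase _ _ (mem_univ i), ← add_sum_erase univ (fun j => g _) (mem_univ i)]
    omega

/-- The charge sent out by a noncodeword is covered by the excess in its closed neighbourhood. -/
theorem Covers.charge_balance (hC : Covers C) (hn : 2 ∣ n) {v : Finset (Fin n)} (hv : v ∉ C) :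
    3 + ballSum (heavyExcess C) v + charge C v * ballSum (light C) v ≤
      3 * ballSum (excess C) v := by
  have hodd := hC.ballSum_excess_odd hn v
  rw [ind_of_notMem hv] at hodd
  by_cases h : 2 ≤ excess C v ∨ ∃ i, 2 ≤ excess C (toggle v i)
  · have hc : charge C v = 3 := by
      simp [charge, hv, h]
    rw [hc, ← ballSum_const_mul, ← ballSum_const_mul, add_assoc, ← ballSum_add, add_comm]
    refine le_ballSum_of_heavy (fun w => ?_) ?_
    · unfold heavyExcess light
      split_ifs <;> omega
    -- Each heavy vertex leaves a slack of 3, so a single one in the ball pays the constant term.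
    · have key : ∀ w, 2 ≤ excess C w →
          heavyExcess C w + 3 * light C w + 3 ≤ 3 * excess C w := by
        intro w hw
        unfold heavyExcess light
        split_ifs <;> omega
      exact h.imp (key v) fun ⟨i, hi⟩ => ⟨i, key _ hi⟩
  · push Not at h
    have h0 : ∀ w, excess C w < 2 → heavyExcess C w = 0 ∧ light C w = excess C w := by
      intro w hw
      unfold heavyExcess light
      split_ifs <;> omega
    have h1 : ballSum (heavyExcess C) v = 0 := by
      simp [ballSum, (h0 v h.1).1, fun i => (h0 _ (h.2 i)).1]
    have h2 : ballSum (light C) v = ballSum (excess C) v := by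
      simp [ballSum, (h0 v h.1).2, fun i => (h0 _ (h.2 i)).2]
    have hc : charge C v = if 2 ≤ ballSum (excess C) v then 2 else 0 := by
      have : ¬ (2 ≤ excess C v ∨ ∃ i, 2 ≤ excess C (toggle v i)) := by
        push Not
        exact h
      simp [charge, hv, this]
    rw [h1, h2, hc]
    -- The ball sum k is odd, so k ≥ 2 means k ≥ 3, and then 3 + 2k ≤ 3k.
    split_ifs <;> omega

/-- The indicator function of the noncodewords. -/
def coind {n : ℕ} (C : Finset (Finset (Fin n))) (v : Finset (Fin n)) : ℕ := if v ∈ C then 0 else 1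

theorem coind_add_ind (v : Finset (Fin n)) : coind C v + ind C v = 1 := by
  unfold coind ind
  split_ifs <;> rfl

theorem Covers.ballSum_coind_add_excess (hC : Covers C) (v : Finset (Fin n)) :
    ballSum (coind C) v + excess C v = n := by
  have h1 := ballSum_add (coind C) (ind C) v
  simp only [coind_add_ind] at h1
  have h2 : ballSum (fun _ : Finset (Fin n) => 1) v = 1 + n := by simp [ballSum]
  have h3 := hC v
  unfold excess
  omega

/-- A heavy codeword has e codeword neighbours and gives at most 6+4 through each; a heavy
noncodeword has e+1 and gives at most 6+1 through each. Both 10e and 7(e+1) are at most 30e-36 for e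
≥ 2. -/
theorem sum_donation_le (hC : Covers C) :
    ∑ z, light C z * (remoteDonation C z + directDonation C z) ≤
      ∑ u, if 2 ≤ excess C u then 30 * excess C u - 36 else 0 := by
  have h1 := sum_remoteDonation_le (C := C)
  have h2 := sum_directDonation_le (C := C)
  calc ∑ z, light C z * (remoteDonation C z + directDonation C z)
      = ∑ z, (if excess C z = 1 then remoteDonation C z else 0) +
          ∑ z, (if excess C z = 1 then directDonation C z else 0) := by
        rw [← sum_add_distrib]
        refine sum_congr rfl fun z _ => ?_
        by_cases h : excess C z = 1 <;> simp [light, h]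
    _ ≤ _ := Nat.add_le_add h1 h2
    _ ≤ _ := by
        rw [← sum_add_distrib]
        refine sum_le_sum fun u _ => ?_
        have h3 := hC.excess_add_one_eq_card u
        by_cases h : 2 ≤ excess C u
        · simp only [h, if_true]
          by_cases hu : u ∈ C
          · rw [ind_of_mem hu] at h3
            simp only [hu, if_true]
            omega
          · rw [ind_of_notMem hu] at h3
            simp only [hu, if_false]
            omega
        · simp [h]

theorem Covers.card_compl_le (hC : Covers C) (hn : 6 ∣ n) (hn12 : 12 ≤ n) :
    ∑ v, coind C v ≤ (n - 3) * ∑ v, excess C v := by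
  have hn2 : 2 ∣ n := (by norm_num : 2 ∣ 6).trans hn
  have hbal : ∑ v, coind C v * 3 + ∑ v, coind C v * ballSum (heavyExcess C) v +
      ∑ v, charge C v * ballSum (light C) v ≤
        ∑ v, coind C v * ballSum (fun w => 3 * excess C w) v := by
    rw [← sum_add_distrib, ← sum_add_distrib]
    refine sum_le_sum fun v _ => ?_
    by_cases hv : v ∈ C
    · simp [coind, charge, hv]
    · have := hC.charge_balance hn2 hv
      simpa [coind, hv, ballSum_const_mul] using this
  have hlight : ∑ v, light C v * 6 ≤ ∑ v, light C v * ballSum (charge C) v +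
      ∑ z, light C z * (remoteDonation C z + directDonation C z) := by
    rw [← sum_add_distrib]
    refine sum_le_sum fun v _ => ?_
    by_cases hv : excess C v = 1
    · have := hC.six_le_charge_add_donation hn (by omega) hv
      simpa [light, hv] using this
    · simp [light, hv]
  have hheavy := sum_donation_le hC
  rw [sum_mul_ballSum, sum_mul_ballSum (charge C), sum_mul_ballSum (coind C)] at hbal
  have hpoint : ∑ v, 3 * excess C v * ballSum (coind C) v +
      ∑ u, (if 2 ≤ excess C u then 30 * excess C u - 36 else 0) ≤
      ∑ v, 3 * ((n - 3) * excess C v) + ∑ v, heavyExcess C v * ballSum (coind C) v +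
        ∑ v, light C v * 6 := by
    rw [← sum_add_distrib, ← sum_add_distrib, ← sum_add_distrib]
    refine sum_le_sum fun v _ => ?_
    have h := hC.ballSum_coind_add_excess v
    generalize ballSum (coind C) v = b at *
    unfold heavyExcess light
    generalize excess C v = e at *
    obtain ⟨m, rfl⟩ := Nat.exists_eq_add_of_le hn12
    rw [show 12 + m - 3 = 9 + m by omega]
    -- For heavy vertices the inequality reduces to 36(e-1) ≤ 3n(e-1), which is where n ≥ 12 is
    -- needed; 30e-36 is the largest allowance that fits at n = 12.
    by_cases h2 : 2 ≤ e
    · obtain ⟨k, rfl⟩ := Nat.exists_eq_add_of_le h2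
      rw [if_pos h2, if_pos h2, if_neg (by omega), show 30 * (2 + k) - 36 = 24 + 30 * k by omega,
        show 2 + k - 1 = 1 + k by omega]
      nlinarith [Nat.zero_le (k * m)]
    · rw [if_neg h2, if_neg h2]
      obtain rfl | rfl : e = 0 ∨ e = 1 := by omega
      · simp
      · simp
        omega
  rw [← mul_sum, ← mul_sum] at hpoint
  rw [← sum_mul] at hbal
  omega

theorem sum_ind : ∑ v, ind C v = #C := by
  simp [ind]

/-- The lower bound `(n - 2) 2 ^ n / (n ^ 2 - 2 n - 2)` for the size of a covering code of
radius one. -/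
theorem Covers.card_lower_bound (hC : Covers C) (hn : 6 ∣ n) (hn12 : 12 ≤ n) :
    (n - 2) * 2 ^ n + (2 * n + 2) * #C ≤ n ^ 2 * #C := by
  have h1 := hC.card_compl_le hn hn12
  have h2 : ∑ v, coind C v + #C = 2 ^ n := by
    rw [← sum_ind, ← sum_add_distrib]
    simp [coind_add_ind]
  have h3 : ∑ v, excess C v + 2 ^ n = (n + 1) * #C := by
    have : ∑ v : Finset (Fin n), (excess C v + 1) = ∑ v, (ind C v + ∑ i, ind C (toggle v i)) :=
      sum_congr rfl fun v _ => hC.excess_add_one v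
    rw [sum_add_distrib, sum_add_distrib, sum_comm (s := univ) (t := (univ : Finset (Fin n)))]
      at this
    simp only [sum_toggle, sum_ind] at this
    simp at this
    linarith
  obtain ⟨m, rfl⟩ := Nat.exists_eq_add_of_le hn12
  rw [show 12 + m - 3 = 9 + m by omega] at h1
  rw [show 12 + m - 2 = 10 + m by omega]
  generalize ∑ v, excess C v = T at *
  generalize ∑ v, coind C v = N at *
  generalize 2 ^ (12 + m) = Q at *
  zify at *
  have hT : (T : ℤ) = (12 + m + 1) * #C - Q := by linarith
  rw [hT] at h1
  linarith

/-! ### From dominating sets to covering codes -/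

theorem exists_eq_toggle_of_ssubset {u v : Finset (Fin n)} (h : u ⊂ v) (hc : #(v \ u) = 1) :
    ∃ i, u = toggle v i ∧ v = toggle u i := by
  obtain ⟨i, hi⟩ := card_eq_one.1 hc
  have hv : v = toggle u i := by
    rw [toggle, ← hi]
    ext x
    have := @h.1 x
    simp only [mem_symmDiff, mem_sdiff]
    tauto
  exact ⟨i, by rw [hv, toggle_toggle], hv⟩

theorem covers_of_isDominatingSet (h : IsDominatingSet (hypercube n) C) : Covers C := by
  intro v
  have hv : v ∈ ⋃ c ∈ C, closedNbhd (hypercube n) c := by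
    rw [show (⋃ c ∈ C, closedNbhd (hypercube n) c) = Set.univ from h]
    exact Set.mem_univ v
  obtain ⟨c, hc, hvc⟩ := Set.mem_iUnion₂.1 hv
  have key : ∀ i, c = toggle v i → 1 ≤ ballSum (ind C) v := by
    rintro i rfl
    have := neighbour_le_ballSum (ind C) v i
    rw [ind_of_mem hc] at this
    omega
  rcases hvc with rfl | ⟨hs, hcard⟩ | ⟨hs, hcard⟩
  · unfold ballSum
    rw [ind_of_mem hc]
    omega
  · obtain ⟨i, hi, -⟩ := exists_eq_toggle_of_ssubset hs hcard
    exact key i hi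
  · obtain ⟨i, -, hi⟩ := exists_eq_toggle_of_ssubset hs hcard
    exact key i hi

theorem dominationNumber_hypercube_lower_bound (hn : 6 ∣ n) (hn12 : 12 ≤ n) :
    (n - 2) * 2 ^ n + (2 * n + 2) * dominationNumber (hypercube n) ≤
      n ^ 2 * dominationNumber (hypercube n) := by
  obtain ⟨S, hS, hcard⟩ := exists_card_eq_dominationNumber (hypercube n)
  rw [← hcard]
  exact (covers_of_isDominatingSet hS).card_lower_bound hn hn12

end HypercubeDomination

theorem corollary1 :
    348 ≤ dominationNumber (hypercube 12) ∧
    14666 ≤ dominationNumber (hypercube 18) ∧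
    701709 ≤ dominationNumber (hypercube 24) ∧
    35876816 ≤ dominationNumber (hypercube 30) := by
  have h12 := dominationNumber_hypercube_lower_bound (n := 12) (by norm_num) (by norm_num)
  have h18 := dominationNumber_hypercube_lower_bound (n := 18) (by norm_num) (by norm_num)
  have h24 := dominationNumber_hypercube_lower_bound (n := 24) (by norm_num) (by norm_num)
  have h30 := dominationNumber_hypercube_lower_bound (n := 30) (by norm_num) (by norm_num)
  norm_num at h12 h18 h24 h30
  -- The four constants are (n-2)2^n/(n²-2n-2) rounded up.
  refine ⟨?_, ?_, ?_, ?_⟩ <;> omega
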